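/- All rings are commutative. Let $R$ be a regular ring, that is, a noetherian ring such that $R_{\mathfrak p}$ is a regular local ring for every prime ideal $\mathfrak p$ of $R$, and assume that its Krull dimension satisfies $\dim R\le 2$. Let $A$ be an $R$-algebra that is a noetherian ring, and let $M$ be a finitely generated $A$-module, regarded as an $R$-module through $R\to A$. Suppose that the $R$-module $M\otimes_R M$ is torsion-free, i.e. for every non-zero-divisor $u\in R$ multiplication by $u$ on $M\otimes_R M$ is injective. Then $M$ is flat over $R$. -/

import Mathlib

open scoped TensorProduct

/-! Let T be the torsion of M. As M ⊗ M is torsion-free, T ⊗ M and M ⊗ T map to zero in it, so M ⊗ M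
= (M/T) ⊗ (M/T). Once M/T is flat, T ⊗ N embeds in M ⊗ N for every N, whence T ⊗ T = 0; since T is
finite over A, this forces T = 0 (`Module.Finite.subsingleton_of_subsingleton_tensor_self`).

It remains to treat torsion-free modules, locally at maximal ideals. Over a principal ideal domain
torsion-free means flat. Otherwise the maximal ideal is (x, y), and flatness follows if xa = yb
always implies b ∈ xM (`Module.Flat.of_isTorsionFree_of_exists_smul_eq`). Such a relation gives a ⊗
b = b ⊗ a in the torsion-free module M ⊗ M; comparing this with a free presentation of M yields b ∈
xM (`Module.Flat.of_isTorsionFree_tensor_self_of_surjective`). -/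

/-! ### Regular local rings of dimension at most two -/

open IsLocalRing in
/-- A noetherian local ring with a principal prime ideal that is not minimal is a domain. -/
lemma isDomain_of_isPrime_span_singleton {R : Type*} [CommRing R] [IsNoetherianRing R]
    [IsLocalRing R] {x : R} (hx : (Ideal.span {x}).IsPrime)
    (hmin : Ideal.span {x} ∉ minimalPrimes R) : IsDomain R := by
  obtain ⟨q, hq, hqx⟩ := Ideal.exists_minimalPrimes_le (bot_le : (⊥ : Ideal R) ≤ Ideal.span {x})
  have hqp : q.IsPrime := hq.1.1
  have hxq : x ∉ q := fun h ↦ hmin <| by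
    rwa [le_antisymm ((Ideal.span_singleton_le_iff_mem _).2 h) hqx]
  -- Every element of q is a multiple wx with w ∈ q, because x ∉ q; so q = xq and Nakayama applies.
  have hbot : q = ⊥ := by
    refine Submodule.eq_bot_of_le_smul_of_le_jacobson_bot (Ideal.span {x}) q
      (IsNoetherian.noetherian q) (fun z hz ↦ ?_) ?_
    · obtain ⟨w, rfl⟩ := Ideal.mem_span_singleton'.1 (hqx hz)
      rw [mul_comm]
      exact Submodule.smul_mem_smul (Ideal.mem_span_singleton_self x)
        ((hqp.mem_or_mem hz).resolve_right hxq)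
    · rw [jacobson_eq_maximalIdeal _ bot_ne_top]
      exact le_maximalIdeal hx.ne_top
  subst hbot
  exact IsDomain.of_bot_isPrime R

open IsLocalRing in
lemma maximalIdeal_notMem_minimalPrimes {R : Type*} [CommRing R] [IsLocalRing R]
    (hdim : 1 ≤ ringKrullDim R) : maximalIdeal R ∉ minimalPrimes R := by
  rw [← Ideal.height_eq_zero_iff]
  intro h
  rw [← maximalIdeal_height_eq_ringKrullDim, h] at hdim
  exact absurd hdim (by decide)

open IsLocalRing in
lemma isDomain_of_maximalIdeal_eq_span_singleton {R : Type*} [CommRing R] [IsNoetherianRing R]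
    [IsLocalRing R] {x : R} (hx : maximalIdeal R = Ideal.span {x}) (hdim : 1 ≤ ringKrullDim R) :
    IsDomain R :=
  isDomain_of_isPrime_span_singleton (hx ▸ (maximalIdeal.isMaximal R).isPrime)
    (hx ▸ maximalIdeal_notMem_minimalPrimes hdim)

open IsLocalRing in
lemma isLocalRing_quotient_span_singleton {R : Type*} [CommRing R]
    [IsLocalRing R] {x : R} (hx : x ∈ maximalIdeal R) : IsLocalRing (R ⧸ Ideal.span {x}) :=
  have : Nontrivial (R ⧸ Ideal.span {x}) := Ideal.Quotient.nontrivial_iff.2 fun h ↦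
    (maximalIdeal.isMaximal R).ne_top
      (top_le_iff.1 (h ▸ (Ideal.span_singleton_le_iff_mem _).2 hx))
  .of_surjective' (Ideal.Quotient.mk _) Ideal.Quotient.mk_surjective

open IsLocalRing in
lemma maximalIdeal_quotient_span_singleton {R : Type*} [CommRing R]
    [IsLocalRing R] {x y : R} (hxy : maximalIdeal R = Ideal.span {x, y})
    [IsLocalRing (R ⧸ Ideal.span {x})] :
    maximalIdeal (R ⧸ Ideal.span {x}) = Ideal.span {Ideal.Quotient.mk _ y} := by
  have h := map_maximalIdeal_of_surjective (Ideal.Quotient.mk (Ideal.span {x}))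
    Ideal.Quotient.mk_surjective
  rw [← h, hxy, Ideal.map_span, Set.image_pair,
    Ideal.Quotient.eq_zero_iff_mem.2 (Ideal.mem_span_singleton_self x), Ideal.span_insert_zero]

open IsLocalRing in
/-- In a noetherian local ring of dimension two, each element of a system of two generators of the
maximal ideal generates a prime ideal. -/
lemma isPrime_span_singleton_of_maximalIdeal_eq_span_pair {R : Type*} [CommRing R]
    [IsNoetherianRing R] [IsLocalRing R] {x y : R} (hxy : maximalIdeal R = Ideal.span {x, y})
    (hdim : 2 ≤ ringKrullDim R) : (Ideal.span {x}).IsPrime := by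
  have hx : x ∈ maximalIdeal R := hxy ▸ Ideal.subset_span (by simp)
  have := isLocalRing_quotient_span_singleton hx
  have h1 := ringKrullDim_le_ringKrullDim_quotient_add_card (R := R) {x}
    (by simpa [IsLocalRing.ringJacobson_eq_maximalIdeal] using hx)
  have hd : 1 ≤ ringKrullDim (R ⧸ Ideal.span {x}) := by
    rw [Finset.coe_singleton, Finset.card_singleton, Nat.cast_one] at h1
    have h2 := hdim.trans h1
    rw [show (2 : WithBot ℕ∞) = 1 + 1 by norm_num] at h2
    exact (ENat.WithBot.add_le_add_one_right_iff).1 h2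
  have := isDomain_of_maximalIdeal_eq_span_singleton (maximalIdeal_quotient_span_singleton hxy) hd
  exact (Ideal.Quotient.isDomain_iff_prime _).1 this

-- Prime avoidance gives a generator z, part of a two-element generating set, outside all minimal
-- primes; then (z) is prime but not minimal.
open IsLocalRing in
lemma isDomain_of_maximalIdeal_eq_span_pair {R : Type*} [CommRing R]
    [IsNoetherianRing R] [IsLocalRing R] {x y : R} (hxy : maximalIdeal R = Ideal.span {x, y})
    (hdim : 2 ≤ ringKrullDim R) : IsDomain R := by
  have h1 : 1 ≤ ringKrullDim R := le_trans (by decide) hdim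
  have hm := maximalIdeal_notMem_minimalPrimes h1
  obtain ⟨z, hz, hz2, hzmin⟩ : ∃ z ∈ maximalIdeal R, z ∉ maximalIdeal R ^ 2 ∧
      ∀ q ∈ minimalPrimes R, z ∉ q := by
    by_contra! hcon
    have hfin : (insert (maximalIdeal R ^ 2) (minimalPrimes R)).Finite :=
      (minimalPrimes.finite_of_isNoetherianRing R).insert _
    obtain ⟨J, hJ, hle⟩ := (Ideal.subset_union_prime_finite hfin (f := id) (I := maximalIdeal R)
      (maximalIdeal R ^ 2) (maximalIdeal R ^ 2)
      (fun J hJ h _ ↦ (hJ.resolve_left h).1.1)).1 (fun z hz ↦ by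
        by_cases h : z ∈ maximalIdeal R ^ 2
        · exact Set.mem_biUnion (Set.mem_insert _ _) h
        · obtain ⟨q, hq, hzq⟩ := hcon z hz h
          exact Set.mem_biUnion (Set.mem_insert_of_mem _ hq) hzq)
    rcases hJ with rfl | hJ
    · have hb : maximalIdeal R = ⊥ := Submodule.eq_bot_of_le_smul_of_le_jacobson_bot
        (maximalIdeal R) _ (IsNoetherian.noetherian _) (by simpa [sq] using hle)
        (by rw [jacobson_eq_maximalIdeal _ bot_ne_top])
      have hf := (isField_iff_maximalIdeal_eq).2 hb
      rw [ringKrullDim_eq_zero_of_isField hf] at h1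
      exact absurd h1 (by decide)
    · exact hm ((le_maximalIdeal hJ.1.1.ne_top).antisymm hle ▸ hJ)
  -- Writing z = ax + by, one of a, b is a unit since z lies outside the square of the maximal
  -- ideal.
  have key : ∃ w, maximalIdeal R = Ideal.span {z, w} := by
    obtain ⟨a, b, rfl⟩ := Ideal.mem_span_pair.1 (hxy ▸ hz)
    have hx : x ∈ maximalIdeal R := hxy ▸ Ideal.subset_span (by simp)
    have hy : y ∈ maximalIdeal R := hxy ▸ Ideal.subset_span (by simp)
    by_cases ha : IsUnit a
    · refine ⟨y, le_antisymm ?_ ?_⟩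
      · rw [hxy, Ideal.span_le, Set.pair_subset_iff]
        obtain ⟨c, hc⟩ := ha.exists_left_inv
        refine ⟨Ideal.mem_span_pair.2 ⟨c, -c * b, ?_⟩, Ideal.subset_span (by simp)⟩
        linear_combination x * hc
      · rw [Ideal.span_le, Set.pair_subset_iff]
        exact ⟨hz, hy⟩
    · by_cases hb : IsUnit b
      · refine ⟨x, le_antisymm ?_ ?_⟩
        · rw [hxy, Ideal.span_le, Set.pair_subset_iff]
          obtain ⟨c, hc⟩ := hb.exists_left_inv
          refine ⟨Ideal.subset_span (by simp), Ideal.mem_span_pair.2 ⟨c, -c * a, ?_⟩⟩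
          linear_combination y * hc
        · rw [Ideal.span_le, Set.pair_subset_iff]
          exact ⟨hz, hx⟩
      · refine absurd ?_ hz2
        rw [sq]
        exact add_mem (Ideal.mul_mem_mul ha hx) (Ideal.mul_mem_mul hb hy)
  obtain ⟨w, hw⟩ := key
  exact isDomain_of_isPrime_span_singleton
    (isPrime_span_singleton_of_maximalIdeal_eq_span_pair hw hdim)
    fun h ↦ hzmin _ h (Ideal.mem_span_singleton_self z)

open IsLocalRing in
/-- A regular local ring of dimension at most two is a domain, and is either a principal ideal ring
or has a maximal ideal generated by two elements. -/
lemma IsRegularLocalRing.isDomain_and_of_ringKrullDim_le_two {R : Type*} [CommRing R]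
    [IsRegularLocalRing R] (hdim : ringKrullDim R ≤ 2) :
    IsDomain R ∧ (IsPrincipalIdealRing R ∨
      2 ≤ ringKrullDim R ∧ ∃ x y : R, maximalIdeal R = Ideal.span {x, y}) := by
  classical
  have hreg := IsRegularLocalRing.spanFinrank_maximalIdeal (R := R)
  have hfg : (maximalIdeal R).FG := IsNoetherian.noetherian _
  have hle : (maximalIdeal R).spanFinrank ≤ 2 := by
    rw [← hreg] at hdim
    exact_mod_cast hdim
  have hPIR [IsDomain R] (h : (maximalIdeal R).IsPrincipal) : IsPrincipalIdealRing R :=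
    ((tfae_of_isNoetherianRing_of_isLocalRing_of_isDomain R).out 4 0).1 h
  obtain ⟨s, hs, hspan⟩ := Submodule.FG.exists_span_finset_card_eq_spanFinrank hfg
  rw [← hs] at hreg hle
  obtain h | h | h : s.card = 0 ∨ s.card = 1 ∨ s.card = 2 := by omega
  · have hbot : maximalIdeal R = ⊥ := by
      rw [← hspan, Finset.card_eq_zero.1 h]
      simp
    have := (isField_iff_maximalIdeal_eq.2 hbot).isDomain
    exact ⟨this, .inl (hPIR (hbot ▸ inferInstance))⟩
  · obtain ⟨x, rfl⟩ := Finset.card_eq_one.1 h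
    have hx : maximalIdeal R = Ideal.span {x} := by simpa using hspan.symm
    have := isDomain_of_maximalIdeal_eq_span_singleton hx (by rw [← hreg, h]; rfl)
    exact ⟨this, .inl (hPIR ⟨x, hx⟩)⟩
  · obtain ⟨x, y, -, rfl⟩ := Finset.card_eq_two.1 h
    have hxy : maximalIdeal R = Ideal.span {x, y} := by simpa using hspan.symm
    have h2 : 2 ≤ ringKrullDim R := by rw [← hreg, h]; rfl
    exact ⟨isDomain_of_maximalIdeal_eq_span_pair hxy h2, .inr ⟨h2, x, y, hxy⟩⟩

open IsLocalRing in
/-- In a two-dimensional regular local ring, a prime ideal avoiding a regular parameter is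
principal. -/
lemma Ideal.IsPrime.isPrincipal_of_notMem_of_maximalIdeal_eq_span_pair {R : Type*} [CommRing R]
    [IsNoetherianRing R] [IsLocalRing R] {x y : R} (hxy : maximalIdeal R = Ideal.span {x, y})
    (hdim : 2 ≤ ringKrullDim R) {p : Ideal R} (hp : p.IsPrime) (hx : x ∉ p) :
    ∃ f, p = Ideal.span {f} := by
  have hxm : x ∈ maximalIdeal R := hxy ▸ Ideal.subset_span (by simp)
  have := isLocalRing_quotient_span_singleton hxm
  have := isPrime_span_singleton_of_maximalIdeal_eq_span_pair hxy hdim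
  have hprin : (maximalIdeal (R ⧸ Ideal.span {x})).IsPrincipal :=
    ⟨_, maximalIdeal_quotient_span_singleton hxy⟩
  have : IsPrincipalIdealRing (R ⧸ Ideal.span {x}) :=
    ((tfae_of_isNoetherianRing_of_isLocalRing_of_isDomain _).out 4 0).1 hprin
  obtain ⟨g, hg⟩ := IsPrincipalIdealRing.principal (p.map (Ideal.Quotient.mk (Ideal.span {x})))
  change _ = Ideal.span {g} at hg
  obtain ⟨f, hfp, rfl⟩ := (Ideal.mem_map_iff_of_surjective _ Ideal.Quotient.mk_surjective).1
    (hg ▸ Ideal.mem_span_singleton_self g)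
  refine ⟨f, le_antisymm ?_ ((Ideal.span_singleton_le_iff_mem _).2 hfp)⟩
  -- Nakayama: for z ∈ p, z - af = bx lies in p for some a, b, and x ∉ p puts b in p.
  refine Submodule.le_of_le_smul_of_le_jacobson_bot (I := maximalIdeal R)
    (IsNoetherian.noetherian p) (by rw [jacobson_eq_maximalIdeal _ bot_ne_top]) fun z hz ↦ ?_
  have hz' := hg ▸ Ideal.mem_map_of_mem (Ideal.Quotient.mk (Ideal.span {x})) hz
  obtain ⟨a, ha⟩ := Ideal.mem_span_singleton'.1 hz'
  obtain ⟨a, rfl⟩ := Ideal.Quotient.mk_surjective a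
  rw [← map_mul, eq_comm, Ideal.Quotient.mk_eq_mk_iff_sub_mem] at ha
  obtain ⟨b, hb⟩ := Ideal.mem_span_singleton'.1 ha
  have hbx : b * x ∈ p := hb ▸ sub_mem hz (Ideal.mul_mem_left _ _ hfp)
  refine Submodule.mem_sup.2 ⟨a * f, Ideal.mul_mem_left _ _ (Ideal.mem_span_singleton_self f),
    x * b, Submodule.smul_mem_smul hxm ((hp.mem_or_mem hbx).resolve_right hx), ?_⟩
  linear_combination hb

open IsLocalRing in
lemma Ideal.IsPrime.eq_maximalIdeal_or_isPrincipal {R : Type*} [CommRing R]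
    [IsNoetherianRing R] [IsLocalRing R] {x y : R} (hxy : maximalIdeal R = Ideal.span {x, y})
    (hdim : 2 ≤ ringKrullDim R) {p : Ideal R} (hp : p.IsPrime) :
    p = maximalIdeal R ∨ ∃ f, p = Ideal.span {f} := by
  by_cases hx : x ∈ p
  · by_cases hy : y ∈ p
    · left
      refine le_antisymm (le_maximalIdeal hp.ne_top) ?_
      rw [hxy, Ideal.span_le, Set.pair_subset_iff]
      exact ⟨hx, hy⟩
    · exact .inr (hp.isPrincipal_of_notMem_of_maximalIdeal_eq_span_pair
        (hxy.trans (by rw [Set.pair_comm])) hdim hy)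
  · exact .inr (hp.isPrincipal_of_notMem_of_maximalIdeal_eq_span_pair hxy hdim hx)

/-! ### Testing flatness on prime ideals -/

/-- The ideals `I` with `I ⊗ M → R ⊗ M` injective form an Oka family. -/
lemma Ideal.isOka_injective_rTensor_subtype (R M : Type*) [CommRing R] [AddCommGroup M]
    [Module R M] :
    Ideal.IsOka fun I : Ideal R ↦ Function.Injective (I.subtype.rTensor M) where
  top := (LinearEquiv.rTensor M (Submodule.topEquiv : (⊤ : Ideal R) ≃ₗ[R] R)).injective
  oka {I a} hJ hC := by
    let C := I.colon (Ideal.span {a} : Ideal R)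
    let J := I ⊔ Ideal.span {a}
    have haJ : a ∈ J := Ideal.mem_sup_right (Ideal.mem_span_singleton_self a)
    have hCI (c : C) : (c : R) * a ∈ I := Ideal.mem_colon_span_singleton.1 c.2
    -- The sequence C → R × I → J, c ↦ (c, -ca), (r, i) ↦ ra + i, is exact with surjective second
    -- map.
    let f : C →ₗ[R] R × I := C.subtype.prod
      (-((LinearMap.mulRight R a ∘ₗ C.subtype).codRestrict I hCI))
    let g : R × I →ₗ[R] J :=
      (LinearMap.toSpanSingleton R J ⟨a, haJ⟩).coprod (Submodule.inclusion le_sup_left)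
    have hg : Function.Surjective g := by
      rintro ⟨z, hz⟩
      obtain ⟨i, hi, w, hw, rfl⟩ := Submodule.mem_sup.1 hz
      obtain ⟨r, rfl⟩ := Ideal.mem_span_singleton'.1 hw
      exact ⟨(r, ⟨i, hi⟩), Subtype.ext (by simp [g, add_comm])⟩
    have hfg : Function.Exact f g := by
      rintro ⟨r, i, hi⟩
      constructor
      · intro h
        have h' : r * a + i = 0 := by simpa [g] using congrArg Subtype.val h
        have hr : r ∈ C := Ideal.mem_colon_span_singleton.2
          (by rw [eq_neg_of_add_eq_zero_left h']; exact neg_mem hi)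
        refine ⟨⟨r, hr⟩, ?_⟩
        ext
        · simp [f]
        · exact (eq_neg_of_add_eq_zero_right h').symm
      · rintro ⟨c, hc⟩
        rw [← hc]
        exact Subtype.ext (add_neg_cancel ((c : R) * a))
    have hex := rTensor_exact M hfg hg
    rw [injective_iff_map_eq_zero] at hJ hC ⊢
    intro t ht
    -- An element t dying in R ⊗ M already dies in J ⊗ M, so (0, t) lifts to some s in C ⊗ M. The
    -- first coordinate forces s = 0, the second then t = 0.
    have h1 : (Submodule.inclusion (le_sup_left : I ≤ J)).rTensor M t = 0 := by
      refine hJ _ ?_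
      rw [← LinearMap.comp_apply, ← LinearMap.rTensor_comp]
      exact ht
    have h2 : g.rTensor M ((LinearMap.inr R R I).rTensor M t) = 0 := by
      rw [← LinearMap.comp_apply, ← LinearMap.rTensor_comp, LinearMap.coprod_inr]
      exact h1
    obtain ⟨s, hs⟩ := (hex _).1 h2
    have h3 := congrArg ((LinearMap.fst R R I).rTensor M) hs
    rw [← LinearMap.comp_apply, ← LinearMap.comp_apply, ← LinearMap.rTensor_comp,
      ← LinearMap.rTensor_comp, LinearMap.fst_comp_inr, LinearMap.rTensor_zero,
      LinearMap.fst_prod] at h3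
    have hs0 : s = 0 := hC _ h3
    have h4 := congrArg ((LinearMap.snd R R I).rTensor M) hs
    rw [hs0, map_zero, map_zero, ← LinearMap.comp_apply, ← LinearMap.rTensor_comp,
      LinearMap.snd_comp_inr, LinearMap.rTensor_id] at h4
    exact h4.symm

/-- Over a noetherian ring, flatness can be tested on prime ideals. -/
lemma Module.Flat.of_forall_isPrime_injective {R M : Type*} [CommRing R] [IsNoetherianRing R]
    [AddCommGroup M] [Module R M]
    (h : ∀ p : Ideal R, p.IsPrime → Function.Injective (p.subtype.rTensor M)) :
    Module.Flat R M := by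
  rw [Module.Flat.iff_rTensor_injective']
  refine (Ideal.isOka_injective_rTensor_subtype R M).forall_of_forall_prime (fun I hI ↦ ?_) h
  obtain ⟨J, hJ, hmax⟩ := set_has_maximal_iff_noetherian.2 ‹IsNoetherianRing R›
    {I : Ideal R | ¬ Function.Injective (I.subtype.rTensor M)} ⟨I, hI⟩
  exact ⟨J, hJ, fun K hK hle ↦ (not_lt_iff_le_imp_ge.1 (hmax K hK)) hle⟩

lemma Ideal.exists_tmul_eq_of_span_pair {R M : Type*} [CommRing R] [AddCommGroup M] [Module R M]
    {x y : R} (t : (Ideal.span {x, y} : Ideal R) ⊗[R] M) :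
    ∃ a b : M, t = (⟨x, Ideal.subset_span (by simp)⟩ : (Ideal.span {x, y} : Ideal R)) ⊗ₜ a +
      (⟨y, Ideal.subset_span (by simp)⟩ : (Ideal.span {x, y} : Ideal R)) ⊗ₜ b := by
  induction t with
  | zero => exact ⟨0, 0, by simp⟩
  | tmul z m =>
    obtain ⟨z, hz⟩ := z
    obtain ⟨r, s, rfl⟩ := Ideal.mem_span_pair.1 hz
    refine ⟨r • m, s • m, ?_⟩
    rw [← TensorProduct.smul_tmul, ← TensorProduct.smul_tmul, ← TensorProduct.add_tmul]
    rfl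
  | add t u ht hu =>
    obtain ⟨a, b, rfl⟩ := ht
    obtain ⟨c, d, rfl⟩ := hu
    refine ⟨a + c, b + d, ?_⟩
    simp only [TensorProduct.tmul_add]
    abel

lemma Ideal.exists_tmul_eq_of_span_singleton {R M : Type*} [CommRing R] [AddCommGroup M]
    [Module R M] {x : R} (t : (Ideal.span {x} : Ideal R) ⊗[R] M) :
    ∃ a : M, t = (⟨x, Ideal.mem_span_singleton_self x⟩ : (Ideal.span {x} : Ideal R)) ⊗ₜ a := by
  induction t with
  | zero => exact ⟨0, by simp⟩
  | tmul z m =>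
    obtain ⟨z, hz⟩ := z
    obtain ⟨r, rfl⟩ := Ideal.mem_span_singleton'.1 hz
    refine ⟨r • m, ?_⟩
    rw [← TensorProduct.smul_tmul]
    rfl
  | add t u ht hu =>
    obtain ⟨a, rfl⟩ := ht
    obtain ⟨b, rfl⟩ := hu
    exact ⟨a + b, by rw [TensorProduct.tmul_add]⟩

/-! ### Flatness over a two-dimensional regular local ring -/

open IsLocalRing in
/-- A torsion-free module of depth two over a two-dimensional regular local ring is flat. -/
lemma Module.Flat.of_isTorsionFree_of_exists_smul_eq {R M : Type*} [CommRing R] [IsDomain R]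
    [IsNoetherianRing R] [IsLocalRing R] {x y : R} (hxy : maximalIdeal R = Ideal.span {x, y})
    (hdim : 2 ≤ ringKrullDim R) (hx : x ≠ 0) [AddCommGroup M] [Module R M]
    [Module.IsTorsionFree R M]
    (h : ∀ a b : M, x • a = y • b → ∃ c, b = x • c) : Module.Flat R M := by
  refine Module.Flat.of_forall_isPrime_injective fun p hp ↦ ?_
  rw [injective_iff_map_eq_zero]
  intro t ht
  replace ht := congrArg (TensorProduct.lid R M) ht
  obtain rfl | ⟨f, rfl⟩ := hp.eq_maximalIdeal_or_isPrincipal hxy hdim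
  · revert t
    rw [hxy]
    intro t ht
    obtain ⟨a, b, rfl⟩ := Ideal.exists_tmul_eq_of_span_pair t
    simp only [map_add, LinearMap.rTensor_tmul, Submodule.subtype_apply, TensorProduct.lid_tmul,
      map_zero] at ht
    obtain ⟨c, hc⟩ := h a (-b) (by rw [smul_neg]; exact eq_neg_of_add_eq_zero_left ht)
    obtain rfl := neg_eq_iff_eq_neg.1 hc
    have ha : a = y • c := by
      refine smul_right_injective M hx ?_
      simp only
      rw [eq_neg_of_add_eq_zero_left ht, smul_neg, neg_neg, smul_comm]
    subst ha
    -- The element is now x ⊗ yc - y ⊗ xc, a Koszul relation.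
    rw [TensorProduct.tmul_neg, ← sub_eq_add_neg, ← TensorProduct.smul_tmul,
      ← TensorProduct.smul_tmul, ← TensorProduct.sub_tmul]
    refine (congrArg (· ⊗ₜ[R] c) (Subtype.ext ?_)).trans (TensorProduct.zero_tmul _ c)
    simp [mul_comm]
  · obtain ⟨a, rfl⟩ := Ideal.exists_tmul_eq_of_span_singleton t
    simp only [LinearMap.rTensor_tmul, Submodule.subtype_apply, TensorProduct.lid_tmul,
      map_zero, smul_eq_zero] at ht
    rcases ht with rfl | rfl
    · exact TensorProduct.zero_tmul _ a
    · simp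

open scoped Pointwise

lemma Finsupp.exists_eq_smul_of_forall_dvd {ι R : Type*} [CommRing R] {x : R} {β : ι →₀ R}
    (h : ∀ i, x ∣ β i) : ∃ γ : ι →₀ R, β = x • γ := by
  classical
  choose g hg using h
  refine ⟨Finsupp.onFinset β.support (fun i ↦ if β i = 0 then 0 else g i) (by simp +contextual), ?_⟩
  ext i
  by_cases hi : β i = 0
  · simp [hi]
  · simp [hi, ← hg i]

/-- Tensoring an injection with flat source by a torsion-free module over a domain is injective. -/
lemma LinearMap.rTensor_injective_of_isTorsionFree {R M P Q : Type*} [CommRing R] [IsDomain R]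
    [AddCommGroup M] [Module R M] [Module.IsTorsionFree R M] [AddCommGroup P] [Module R P]
    [AddCommGroup Q] [Module R Q] [Module.Flat R P] (f : P →ₗ[R] Q) (hf : Function.Injective f) :
    Function.Injective (f.rTensor M) := by
  let K := FractionRing R
  let j : M →ₗ[R] K ⊗[R] M := TensorProduct.mk R K M 1
  have hj : Function.Injective j := by
    have : IsLocalizedModule (nonZeroDivisors R) j :=
      (isLocalizedModule_iff_isBaseChange (nonZeroDivisors R) K j).2
        (TensorProduct.isBaseChange R M K)
    rw [injective_iff_map_eq_zero]
    intro m hm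
    obtain ⟨c, hc⟩ := (IsLocalizedModule.eq_zero_iff (nonZeroDivisors R) j).1 hm
    exact (smul_eq_zero.1 hc).resolve_left (nonZeroDivisors.ne_zero c.2)
  have : Module.Flat R K := IsLocalization.flat K (nonZeroDivisors R)
  have : Module.Flat R (K ⊗[R] M) := Module.Flat.trans R K _
  -- The map P ⊗ M → P ⊗ (K ⊗ M) → Q ⊗ (K ⊗ M) is injective and factors through Q ⊗ M.
  have h1 : Function.Injective (f.rTensor (K ⊗[R] M) ∘ₗ j.lTensor P) :=
    (Module.Flat.rTensor_preserves_injective_linearMap f hf).comp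
      (Module.Flat.lTensor_preserves_injective_linearMap j hj)
  rw [LinearMap.rTensor_comp_lTensor, ← LinearMap.lTensor_comp_rTensor] at h1
  exact Function.Injective.of_comp h1

open IsLocalRing in
/-- If `P` is flat and `p ⊗ n = 0` where `n` is a nonzero element killed by the maximal ideal, then
`p` lies in the maximal ideal times `P`. -/
lemma Module.Flat.mem_maximalIdeal_smul_top_of_tmul_eq_zero {R P N : Type*} [CommRing R]
    [IsLocalRing R] [AddCommGroup P] [Module R P] [Module.Flat R P] [AddCommGroup N] [Module R N]
    {p : P} {n : N} (hn : n ≠ 0) (hm : ∀ r ∈ maximalIdeal R, r • n = 0) (h : p ⊗ₜ[R] n = 0) :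
    p ∈ maximalIdeal R • (⊤ : Submodule R P) := by
  let f := LinearMap.toSpanSingleton R N n
  have hle : maximalIdeal R ≤ LinearMap.ker f := fun r hr ↦ by simpa [f] using hm r hr
  -- The residue field embeds in N by 1 ↦ n; tensoring with the flat P embeds P/𝔪P in P ⊗ N.
  let g : (R ⧸ maximalIdeal R) →ₗ[R] N := Submodule.liftQ (maximalIdeal R) f hle
  have hg : Function.Injective g := by
    refine LinearMap.ker_eq_bot.1 (Submodule.ker_liftQ_eq_bot _ _ _ ?_)
    refine le_maximalIdeal fun htop ↦ hn ?_
    have : (1 : R) ∈ LinearMap.ker f := htop ▸ Submodule.mem_top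
    simpa [f] using this
  have h0 : p ⊗ₜ[R] (Submodule.Quotient.mk 1 : R ⧸ maximalIdeal R) = 0 := by
    refine (injective_iff_map_eq_zero _).1
      (Module.Flat.lTensor_preserves_injective_linearMap (M := P) g hg) _ ?_
    rw [LinearMap.lTensor_tmul, ← h]
    exact congrArg (p ⊗ₜ[R] ·) (one_smul R n)
  have h1 := congrArg (TensorProduct.tensorQuotEquivQuotSMul P (maximalIdeal R)) h0
  rw [map_zero] at h1
  have h2 := TensorProduct.tensorQuotEquivQuotSMul_tmul_mk (maximalIdeal R) p (1 : R)
  erw [h2, one_smul] at h1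
  exact (Submodule.Quotient.mk_eq_zero _).1 h1

lemma Ideal.exists_eq_add_of_mem_span_pair_smul_top {R P : Type*} [CommRing R] [AddCommGroup P]
    [Module R P] {x y : R} {p : P} (hp : p ∈ Ideal.span {x, y} • (⊤ : Submodule R P)) :
    ∃ a b : P, p = x • a + y • b := by
  rw [Ideal.span_insert, Submodule.sup_smul, Submodule.ideal_span_singleton_smul,
    Submodule.ideal_span_singleton_smul] at hp
  obtain ⟨u, hu, v, hv, rfl⟩ := Submodule.mem_sup.1 hp
  obtain ⟨a, -, rfl⟩ := (Submodule.mem_smul_pointwise_iff_exists _ _ _).1 hu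
  obtain ⟨b, -, rfl⟩ := (Submodule.mem_smul_pointwise_iff_exists _ _ _).1 hv
  exact ⟨a, b, rfl⟩

open IsLocalRing in
lemma notMem_span_singleton_of_maximalIdeal_eq_span_pair {R : Type*} [CommRing R]
    [IsNoetherianRing R] [IsLocalRing R] {x y : R} (hxy : maximalIdeal R = Ideal.span {x, y})
    (hdim : 2 ≤ ringKrullDim R) : y ∉ Ideal.span {x} := by
  intro h
  have hx : maximalIdeal R = Ideal.span {x} := by
    rw [hxy]
    exact le_antisymm (Ideal.span_le.2 (Set.pair_subset_iff.2
      ⟨Ideal.mem_span_singleton_self x, h⟩)) (Ideal.span_mono (by simp))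
  have h1 : (maximalIdeal R).spanFinrank ≤ 1 := by
    rw [hx]
    exact (Submodule.spanFinrank_span_le_ncard_of_finite (Set.finite_singleton x)).trans (by simp)
  have h2 : (2 : WithBot ℕ∞) ≤ (1 : ℕ) :=
    (hdim.trans (ringKrullDim_le_spanFinrank_maximalIdeal R)).trans (by exact_mod_cast h1)
  exact absurd h2 (by decide)

-- Given xa = yb, lift a, b to α, β in F. Then φ = xα - yβ lies in the kernel F₁ of π, and a ⊗ b = b
-- ⊗ a makes φ ⊗ b divisible by x in F₁ ⊗ M. If b ∉ xM, its class in M/xM is nonzero and killed by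
-- the maximal ideal, so flatness of F₁ puts φ in (x, y)F₁. Correcting the lifts then gives a
-- relation in F, where it can be solved.
open IsLocalRing in
lemma Module.Flat.of_isTorsionFree_tensor_self_of_surjective {R M F : Type*} [CommRing R]
    [IsDomain R] [IsNoetherianRing R] [IsLocalRing R] {x y : R}
    (hxy : maximalIdeal R = Ideal.span {x, y}) (hdim : 2 ≤ ringKrullDim R) (hx0 : x ≠ 0)
    [AddCommGroup M] [Module R M] [Module.IsTorsionFree R M] [Module.IsTorsionFree R (M ⊗[R] M)]
    [AddCommGroup F] [Module R F] [Module.IsTorsionFree R F]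
    (hF : ∀ α β : F, x • α = y • β → ∃ γ, β = x • γ)
    (π : F →ₗ[R] M) (hπ : Function.Surjective π) : Module.Flat R M := by
  let F₁ := LinearMap.ker π
  have hF₁ : Module.Flat R F₁ := by
    refine Module.Flat.of_isTorsionFree_of_exists_smul_eq (M := F₁) hxy hdim hx0 fun a b hab ↦ ?_
    obtain ⟨γ, hγ⟩ := hF a b (congrArg Subtype.val hab)
    have hb : π b = 0 := b.2
    rw [hγ, map_smul] at hb
    exact ⟨⟨γ, (smul_eq_zero.1 hb).resolve_left hx0⟩, Subtype.ext hγ⟩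
  refine Module.Flat.of_isTorsionFree_of_exists_smul_eq hxy hdim hx0 fun a b hab ↦ ?_
  have hcomm : a ⊗ₜ[R] b = b ⊗ₜ a := by
    refine smul_right_injective (M ⊗[R] M) hx0 ?_
    simp only
    rw [TensorProduct.smul_tmul', ← TensorProduct.tmul_smul, hab, TensorProduct.tmul_smul,
      TensorProduct.smul_tmul']
  obtain ⟨α, rfl⟩ := hπ a
  obtain ⟨β, rfl⟩ := hπ b
  have hφ : x • α - y • β ∈ F₁ := by
    simp [F₁, hab]
  have hker : Function.Exact F₁.subtype π := LinearMap.exact_subtype_ker_map π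
  have hex := _root_.rTensor_exact M hker hπ
  obtain ⟨t, ht⟩ := (hex (α ⊗ₜ π β - β ⊗ₜ π α)).1 (by simp [hcomm])
  -- The equality is checked in F ⊗ M, into which F₁ ⊗ M embeds since F₁ is flat and M torsion-free.
  have hxt : (⟨x • α - y • β, hφ⟩ : F₁) ⊗ₜ[R] π β = x • t := by
    refine LinearMap.rTensor_injective_of_isTorsionFree F₁.subtype F₁.injective_subtype ?_
    rw [map_smul, ht, smul_sub, ← TensorProduct.tmul_smul x β, hab, TensorProduct.tmul_smul,
      TensorProduct.smul_tmul', TensorProduct.smul_tmul', ← TensorProduct.sub_tmul]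
    rfl
  by_contra! hb
  let N := M ⧸ (x • (⊤ : Submodule R M))
  have hxN (m : M) : (Submodule.Quotient.mk (x • m) : N) = 0 :=
    (Submodule.Quotient.mk_eq_zero _).2 (Submodule.smul_mem_pointwise_smul _ _ _ trivial)
  have hbN : (Submodule.Quotient.mk (π β) : N) ≠ 0 := fun h ↦ by
    obtain ⟨c, -, hc⟩ := (Submodule.mem_smul_pointwise_iff_exists _ _ _).1
      ((Submodule.Quotient.mk_eq_zero _).1 h)
    exact hb c hc.symm
  have hmem := Module.Flat.mem_maximalIdeal_smul_top_of_tmul_eq_zero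
    (p := (⟨x • α - y • β, hφ⟩ : F₁)) hbN (fun r hr ↦ by
      obtain ⟨u, v, rfl⟩ := Ideal.mem_span_pair.1 (hxy ▸ hr)
      rw [← Submodule.Quotient.mk_smul, add_smul, mul_smul, mul_smul, ← hab, smul_comm u x,
        smul_comm v x, ← smul_add]
      exact hxN _) (by
      have h1 := congrArg ((x • (⊤ : Submodule R M)).mkQ.lTensor F₁) hxt
      rw [LinearMap.lTensor_tmul] at h1
      refine h1.trans ?_
      generalize t = t
      induction t with
      | zero => simp
      | tmul p m =>
        rw [← TensorProduct.tmul_smul, LinearMap.lTensor_tmul, Submodule.mkQ_apply, hxN,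
          TensorProduct.tmul_zero]
      | add s t hs ht => rw [smul_add, map_add, hs, ht, add_zero])
  rw [hxy] at hmem
  obtain ⟨α', β', h⟩ := Ideal.exists_eq_add_of_mem_span_pair_smul_top hmem
  have h' : x • α - y • β = x • (α' : F) + y • (β' : F) := congrArg Subtype.val h
  -- As α', β' lie in F₁, these are still lifts of a and b.
  obtain ⟨γ, hγ⟩ := hF (α - α') (β + β') (by
    rw [smul_sub, smul_add, sub_eq_iff_eq_add, ← sub_eq_iff_eq_add', ← sub_sub]
    rw [sub_eq_iff_eq_add] at h' ⊢
    rw [h']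
    abel_nf)
  refine hb (π γ) ?_
  rw [← map_smul, ← hγ, map_add, show π β' = 0 from β'.2, add_zero]

open IsLocalRing in
/-- Over a two-dimensional regular local ring, a torsion-free module whose tensor square is
torsion-free is flat. -/
lemma Module.Flat.of_isTorsionFree_tensor_self_of_span_pair {R M : Type*} [CommRing R] [IsDomain R]
    [IsNoetherianRing R] [IsLocalRing R] {x y : R} (hxy : maximalIdeal R = Ideal.span {x, y})
    (hdim : 2 ≤ ringKrullDim R) [AddCommGroup M] [Module R M]
    [Module.IsTorsionFree R M] [Module.IsTorsionFree R (M ⊗[R] M)] : Module.Flat R M := by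
  have hyx := notMem_span_singleton_of_maximalIdeal_eq_span_pair hxy hdim
  have hx0 : x ≠ 0 := by
    rintro rfl
    refine notMem_span_singleton_of_maximalIdeal_eq_span_pair
      (hxy.trans (by rw [Set.pair_comm])) hdim (zero_mem _)
  have hprime := isPrime_span_singleton_of_maximalIdeal_eq_span_pair hxy hdim
  have hF (α β : M →₀ R) (h : x • α = y • β) : ∃ γ, β = x • γ := by
    refine Finsupp.exists_eq_smul_of_forall_dvd fun i ↦ ?_
    have hi : x * α i = y * β i := DFunLike.congr_fun h i
    rw [← Ideal.mem_span_singleton]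
    refine (hprime.mem_or_mem (?_ : y * β i ∈ _)).resolve_left hyx
    exact Ideal.mem_span_singleton.2 ⟨_, hi.symm⟩
  exact Module.Flat.of_isTorsionFree_tensor_self_of_surjective hxy hdim hx0 hF
    (Finsupp.linearCombination R id) (Finsupp.linearCombination_id_surjective R M)

/-- Over a regular local ring of dimension at most two, a torsion-free module whose tensor square is
torsion-free is flat. -/
lemma IsRegularLocalRing.flat_of_isTorsionFree_tensor_self {R M : Type*} [CommRing R]
    [IsRegularLocalRing R] (hdim : ringKrullDim R ≤ 2) [AddCommGroup M] [Module R M]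
    [Module.IsTorsionFree R M] [Module.IsTorsionFree R (M ⊗[R] M)] : Module.Flat R M := by
  obtain ⟨_, _ | ⟨h2, x, y, hxy⟩⟩ := IsRegularLocalRing.isDomain_and_of_ringKrullDim_le_two hdim
  · exact Module.Flat.flat_iff_torsion_eq_bot_of_isBezout.2
      (Submodule.isTorsionFree_iff_torsion_eq_bot.1 inferInstance)
  · exact Module.Flat.of_isTorsionFree_tensor_self_of_span_pair hxy h2

/-! ### From local to global -/

/-- If all localizations of a noetherian ring at maximal ideals are domains, then the kernel of each
of the localization maps is generated by an idempotent. -/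
lemma Localization.AtPrime.exists_isIdempotentElem_ker_algebraMap {R : Type*} [CommRing R]
    [IsNoetherianRing R]
    (hR : ∀ (P : Ideal R) [P.IsMaximal], IsDomain (Localization.AtPrime P))
    (P : Ideal R) [P.IsMaximal] :
    ∃ e : R, IsIdempotentElem e ∧
      RingHom.ker (algebraMap R (Localization.AtPrime P)) = Ideal.span {e} := by
  have := hR P
  set p := RingHom.ker (algebraMap R (Localization.AtPrime P)) with hp
  have hprime : p.IsPrime := RingHom.ker_isPrime _
  have hkill (z : R) (hz : z ∈ p) : ∃ c ∉ p, c * z = 0 := by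
    obtain ⟨c, hc⟩ := (IsLocalization.map_eq_zero_iff P.primeCompl (Localization.AtPrime P) z).1 hz
    refine ⟨c, fun hcp ↦ ?_, hc⟩
    obtain ⟨s, hs⟩ :=
      (IsLocalization.map_eq_zero_iff P.primeCompl (Localization.AtPrime P) c.1).1 hcp
    exact (s * c).2 (by simp [hs])
  refine (Ideal.isIdempotentElem_iff_of_fg p (IsNoetherian.noetherian p)).1 ?_
  -- Idempotence of p is local: at Q ⊇ p the ideal p becomes zero, elsewhere it becomes the unit
  -- ideal.
  refine Ideal.eq_of_localization_maximal fun Q hQ ↦ ?_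
  rw [Ideal.map_mul]
  by_cases hle : p ≤ Q
  · have := hR Q
    have hbot : p.map (algebraMap R (Localization.AtPrime Q)) = ⊥ := by
      rw [Ideal.map_eq_bot_iff_le_ker]
      intro z hz
      obtain ⟨c, hc, hcz⟩ := hkill z hz
      have h := congrArg (algebraMap R (Localization.AtPrime Q)) hcz
      rw [map_mul, map_zero] at h
      refine (mul_eq_zero.1 h).resolve_left fun hc0 ↦ hc ?_
      obtain ⟨s, hs⟩ :=
        (IsLocalization.map_eq_zero_iff Q.primeCompl (Localization.AtPrime Q) c).1 hc0
      exact (hprime.mem_or_mem (hs ▸ zero_mem p)).resolve_left fun h ↦ s.2 (hle h)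
    rw [hbot, Ideal.mul_bot]
  · rw [IsLocalization.AtPrime.map_eq_top_of_not_le _ hle, Ideal.top_mul]

/-- Torsion-free modules over a noetherian ring which is locally a domain localize to torsion-free
modules. -/
lemma IsLocalizedModule.isTorsionFree_atPrime {R N N' : Type*} [CommRing R]
    [IsNoetherianRing R]
    (hR : ∀ (P : Ideal R) [P.IsMaximal], IsDomain (Localization.AtPrime P))
    (P : Ideal R) [P.IsMaximal] [AddCommGroup N] [Module R N] [AddCommGroup N'] [Module R N']
    [Module (Localization.AtPrime P) N'] [IsScalarTower R (Localization.AtPrime P) N']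
    (f : N →ₗ[R] N') [IsLocalizedModule P.primeCompl f] [Module.IsTorsionFree R N] :
    Module.IsTorsionFree (Localization.AtPrime P) N' := by
  refine ⟨fun a ha ↦ ?_⟩
  obtain ⟨e, he, hker⟩ := Localization.AtPrime.exists_isIdempotentElem_ker_algebraMap hR P
  have hD := hR P
  have hprime : (Ideal.span {e}).IsPrime := hker ▸ RingHom.ker_isPrime _
  have hee : e * e = e := he
  have heP : 1 - e ∉ P := by
    have heP' : algebraMap R (Localization.AtPrime P) e = 0 := by
      rw [← RingHom.mem_ker, hker]
      exact Ideal.mem_span_singleton_self e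
    intro h
    have h2 := (IsLocalization.AtPrime.to_map_mem_maximal_iff (Localization.AtPrime P) P (1 - e)).2 h
    rw [map_sub, heP', sub_zero, map_one] at h2
    exact (IsLocalRing.maximalIdeal.isMaximal (Localization.AtPrime P)).ne_top
      ((Ideal.eq_top_iff_one _).2 h2)
  obtain ⟨r, s, rfl⟩ := IsLocalization.exists_mk'_eq P.primeCompl a
  have hr : r ∉ Ideal.span {e} := by
    rw [← hker]
    intro h
    refine ha.ne_zero ?_
    rw [IsLocalization.mk'_eq_mul_mk'_one, (RingHom.mem_ker).1 h, zero_mul]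
  -- The numerator r may be a zero divisor in R. Since e vanishes in the localization, this element
  -- has the same image there, and it is regular in R.
  have hu : IsRegular ((1 - e) * r + e) := by
    rw [isRegular_iff_mem_nonZeroDivisors, mem_nonZeroDivisors_iff_right]
    intro w hw
    have h1 : e * w = 0 := by linear_combination e * hw + (r * w - w) * hee
    have h2 : r * w ∈ Ideal.span {e} := by
      refine Ideal.mem_span_singleton.2 ⟨r * w, ?_⟩
      linear_combination hw - h1
    obtain ⟨v, rfl⟩ := Ideal.mem_span_singleton.1 ((hprime.mem_or_mem h2).resolve_left hr)
    linear_combination h1 - v * hee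
  suffices h : ∀ z : N', IsLocalization.mk' (Localization.AtPrime P) r s • z = 0 → z = 0 from
    fun z w hzw ↦ sub_eq_zero.1 (h _ (by rw [smul_sub, sub_eq_zero]; exact hzw))
  intro z hz
  obtain ⟨⟨n, t⟩, rfl⟩ := IsLocalizedModule.mk'_surjective P.primeCompl f z
  simp only [Function.uncurry_apply_pair] at hz ⊢
  rw [IsLocalizedModule.mk'_smul_mk', IsLocalizedModule.mk'_eq_zero,
    IsLocalizedModule.eq_zero_iff P.primeCompl f] at hz
  obtain ⟨c, hc⟩ := hz
  rw [IsLocalizedModule.mk'_eq_zero, IsLocalizedModule.eq_zero_iff P.primeCompl f]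
  refine ⟨⟨1 - e, heP⟩ * c, ?_⟩
  rw [← hu.smul_eq_zero_iff_right (M := N)]
  have hc' : (c : R) • r • n = 0 := hc
  rw [Submonoid.smul_def, ← mul_smul, Submonoid.coe_mul, show ((1 - e) * r + e) * ((1 - e) * c) =
    (1 - e) * (c * r) by linear_combination (r * c - c) * hee, mul_smul, mul_smul, hc', smul_zero]

/-- Over a regular ring of dimension at most two, a torsion-free module whose tensor square is
torsion-free is flat. -/
lemma IsRegularRing.flat_of_isTorsionFree_tensor_self {R M : Type*} [CommRing R]
    [IsRegularRing R] (hdim : ringKrullDim R ≤ 2) [AddCommGroup M] [Module R M]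
    [Module.IsTorsionFree R M] [Module.IsTorsionFree R (M ⊗[R] M)] : Module.Flat R M := by
  have hd (P : Ideal R) [P.IsMaximal] : ringKrullDim (Localization.AtPrime P) ≤ 2 := by
    rw [IsLocalization.AtPrime.ringKrullDim_eq_height P]
    exact Ideal.height_le_ringKrullDim_of_isPrime.trans hdim
  have hR (P : Ideal R) [P.IsMaximal] : IsDomain (Localization.AtPrime P) :=
    (IsRegularLocalRing.isDomain_and_of_ringKrullDim_le_two (hd P)).1
  refine Module.flat_of_localized_maximal _ fun P hP ↦ ?_
  let f := LocalizedModule.mkLinearMap P.primeCompl M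
  have h1 : Module.IsTorsionFree (Localization.AtPrime P) (LocalizedModule P.primeCompl M) :=
    IsLocalizedModule.isTorsionFree_atPrime hR P f
  have h2 : Module.IsTorsionFree (Localization.AtPrime P)
      (LocalizedModule P.primeCompl M ⊗[R] LocalizedModule P.primeCompl M) :=
    IsLocalizedModule.isTorsionFree_atPrime hR P (TensorProduct.map f f)
  let e := IsLocalization.moduleTensorEquiv P.primeCompl (Localization.AtPrime P)
    (LocalizedModule P.primeCompl M) (LocalizedModule P.primeCompl M)
  have h3 : Module.IsTorsionFree (Localization.AtPrime P)
      (LocalizedModule P.primeCompl M ⊗[Localization.AtPrime P] LocalizedModule P.primeCompl M) :=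
    e.injective.moduleIsTorsionFree e fun r m ↦ map_smul e r m
  have h4 : Module.Flat (Localization.AtPrime P) (LocalizedModule P.primeCompl M) :=
    IsRegularLocalRing.flat_of_isTorsionFree_tensor_self (hd P)
  have : Module.Flat R (Localization.AtPrime P) := IsLocalization.flat _ P.primeCompl
  exact Module.Flat.trans R (Localization.AtPrime P) _

/-! ### Eliminating the torsion -/

/-- A finite module is zero if its tensor square over a subring is zero. -/
lemma Module.Finite.subsingleton_of_subsingleton_tensor_self {R A T : Type*} [CommRing R]
    [CommRing A] [Algebra R A] [AddCommGroup T] [Module R T] [Module A T] [IsScalarTower R A T]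
    [Module.Finite A T] [Subsingleton (T ⊗[R] T)] : Subsingleton T := by
  have h : Subsingleton (T ⊗[A] T) :=
    (TensorProduct.mapOfCompatibleSMul_surjective A R R T T).subsingleton
  by_contra hT
  rw [not_subsingleton_iff_nontrivial] at hT
  -- At a prime of the support the fibre is a nonzero vector space, whose tensor square cannot
  -- vanish.
  obtain ⟨p, hp⟩ := Module.nonempty_support_of_nontrivial (R := A) (M := T)
  let K := p.asIdeal.ResidueField
  have h1 : Nontrivial (K ⊗[A] T) :=
    (Module.mem_support_iff_nontrivial_residueField_tensorProduct p).1 hp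
  let e := TensorProduct.AlgebraTensorModule.distribBaseChange A K T T
  have h2 : Subsingleton (K ⊗[A] (T ⊗[A] T)) := inferInstance
  have h3 : Subsingleton ((K ⊗[A] T) ⊗[K] (K ⊗[A] T)) := e.symm.toEquiv.subsingleton
  have h4 : Nontrivial ((K ⊗[A] T) ⊗[K] (K ⊗[A] T)) := inferInstance
  exact not_subsingleton _ h3

lemma Submodule.isTorsionFree_quotient_torsion (R M : Type*) [CommRing R] [AddCommGroup M]
    [Module R M] : Module.IsTorsionFree R (M ⧸ Submodule.torsion R M) := by
  refine ⟨fun r hr z w hzw ↦ ?_⟩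
  have h : z - w ∈ Submodule.torsion R (M ⧸ Submodule.torsion R M) := by
    refine ⟨⟨r, isRegular_iff_mem_nonZeroDivisors.1 hr⟩, ?_⟩
    change r • (z - w) = 0
    rw [smul_sub, sub_eq_zero]
    exact hzw
  rw [Submodule.QuotientTorsion.torsion_eq_bot] at h
  exact sub_eq_zero.1 h

/-- An element of `torsion M ⊗ N` is killed by any map to a torsion-free module. -/
lemma Submodule.map_tmul_torsion_eq_zero {R M N P : Type*} [CommRing R] [AddCommGroup M]
    [Module R M] [AddCommGroup N] [Module R N] [AddCommGroup P] [Module R P]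
    [Module.IsTorsionFree R P] (f : Submodule.torsion R M ⊗[R] N →ₗ[R] P) : f = 0 := by
  refine TensorProduct.ext' fun t n ↦ ?_
  obtain ⟨⟨t, ⟨u, hu⟩⟩, rfl⟩ : ∃ t', t = t' := ⟨t, rfl⟩
  refine ((isRegular_iff_mem_nonZeroDivisors.2 u.2).smul_eq_zero_iff_right (M := P)).1 ?_
  rw [← map_smul, TensorProduct.smul_tmul']
  have : (u : R) • (⟨t, ⟨u, hu⟩⟩ : Submodule.torsion R M) = 0 := Subtype.ext hu
  rw [this, TensorProduct.zero_tmul, map_zero]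

theorem proposition5p1 {R A M : Type*} [CommRing R] [IsRegularRing R]
    (hdim : ringKrullDim R ≤ 2)
    [CommRing A] [IsNoetherianRing A] [Algebra R A]
    [AddCommGroup M] [Module R M] [Module A M] [IsScalarTower R A M] [Module.Finite A M]
    (htf : Module.IsTorsionFree R (M ⊗[R] M)) :
    Module.Flat R M := by
  let T := Submodule.torsion R M
  have hTM : T.subtype.rTensor M = 0 := Submodule.map_tmul_torsion_eq_zero _
  have hMT : T.subtype.lTensor M = 0 := by
    have h : T.subtype.lTensor M ∘ₗ (TensorProduct.comm R T M).toLinearMap = 0 :=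
      Submodule.map_tmul_torsion_eq_zero _
    ext m t
    exact LinearMap.congr_fun h (t ⊗ₜ m)
  have hex : Function.Exact T.subtype T.mkQ := LinearMap.exact_subtype_mkQ T
  have hker := TensorProduct.map_ker hex T.mkQ_surjective hex T.mkQ_surjective
  rw [hTM, hMT, LinearMap.range_zero, LinearMap.range_zero, sup_bot_eq] at hker
  have := Submodule.isTorsionFree_quotient_torsion R M
  let e := LinearEquiv.ofBijective (TensorProduct.map T.mkQ T.mkQ)
    ⟨LinearMap.ker_eq_bot.1 hker,
      TensorProduct.map_surjective T.mkQ_surjective T.mkQ_surjective⟩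
  have : Module.IsTorsionFree R ((M ⧸ T) ⊗[R] (M ⧸ T)) :=
    e.symm.injective.moduleIsTorsionFree e.symm fun r m ↦ map_smul e.symm r m
  have hflat : Module.Flat R (M ⧸ T) := IsRegularRing.flat_of_isTorsionFree_tensor_self hdim
  have hinj (N : Type _) [AddCommGroup N] [Module R N] :
      Function.Injective (T.subtype.lTensor N) :=
    LinearMap.lTensor_injective_of_exact_of_flat T.mkQ T.mkQ_surjective T.subtype
      T.injective_subtype hex N
  have hTM0 : Subsingleton (T ⊗[R] T) := by
    have hM0 : Subsingleton (M ⊗[R] T) :=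
      ⟨fun a b ↦ hinj M (by rw [hMT]; rfl)⟩
    have hT0 : Subsingleton (T ⊗[R] M) := (TensorProduct.comm R T M).toEquiv.subsingleton
    exact (hinj T).subsingleton
  -- The R-torsion is stable under A, hence finite over the noetherian ring A.
  let TA : Submodule A M :=
    { T with
      smul_mem' := fun a m ⟨u, hu⟩ ↦ ⟨u, by
        change (u : R) • a • m = 0
        rw [smul_comm, show (u : R) • m = 0 from hu, smul_zero]⟩ }
  let i : TA ≃ₗ[R] T :=
    { toFun := fun z ↦ ⟨z.1, z.2⟩
      invFun := fun z ↦ ⟨z.1, z.2⟩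
      map_add' := fun _ _ ↦ rfl
      map_smul' := fun _ _ ↦ rfl }
  have : Subsingleton (TA ⊗[R] TA) := (TensorProduct.congr i i).toEquiv.subsingleton
  have : Subsingleton TA := Module.Finite.subsingleton_of_subsingleton_tensor_self (R := R) (A := A)
  have hT : T = ⊥ := by
    have : Subsingleton T := i.symm.toEquiv.subsingleton
    exact (Submodule.subsingleton_iff_eq_bot).1 this
  exact Module.Flat.of_linearEquiv (Submodule.quotEquivOfEqBot T hT).symm
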